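/- Let $X$ be a nonempty countable set, let $b\colon X\times X\to[0,\infty)$ satisfy $b(x,y)=b(y,x)$, $b(x,x)=0$ and $\sum_{z\in X}b(x,z)<\infty$ for all $x,y\in X$, and let $\mu\colon X\to(0,\infty)$. Let $\ell^2(X,\mu)$ be the Hilbert space of functions $f\colon X\to\mathbb{C}$ with $\sum_{x}\mu(x)|f(x)|^2<\infty$, with inner product $(f,g)=\sum_x\mu(x)f(x)\overline{g(x)}$ and norm $\|\cdot\|$, and let $C_c(X)$ be the space of finitely supported functions $X\to\mathbb{C}$. Assume the finiteness condition (FC): for every $x\in X$ the function $y\mapsto b(x,y)/\mu(y)$ belongs to $\ell^2(X,\mu)$. Let $V_1\colon X\to\mathbb{R}$ and, for $u\in C_c(X)$, put $$\mathcal{L}_{V_1}u(x)=\frac{1}{\mu(x)}\sum_{y\in X}b(x,y)\,(u(x)-u(y))+V_1(x)u(x),\qquad x\in X;$$ by (FC) this is an operator in $\ell^2(X,\mu)$ with domain $C_c(X)$, and it is symmetric. Assume that it is lower semi-bounded: there is $C\in\mathbb{R}$ with $(\mathcal{L}_{V_1}u,u)\ge C\|u\|^2$ for all $u\in C_c(X)$.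 Let $h$ be the closure of the form $u\mapsto(\mathcal{L}_{V_1}u,u)$, $u\in C_c(X)$, and let $L_{V_1}$, the Friedrichs extension of $\mathcal{L}_{V_1}|_{C_c(X)}$, be the self-adjoint operator associated with $h$. Let $\lambda_0(h)$ be the largest $c\in\mathbb{R}$ with $h(u)\ge c\|u\|^2$ for all $u\in\mathrm{Dom}(h)$, and for $\beta>0$ let $\|u\|_{h}^2=h(u)+(\beta-\lambda_0(h))\|u\|^2$ be the form norm (different $\beta$ give equivalent norms). Then $L_{V_1}$ has a positive form core: for every $u\in\mathrm{Dom}(h)$ with $u(x)\ge 0$ for all $x\in X$ there is a sequence $u_k\in C_c(X)$ with $u_k(x)\ge 0$ for all $x\in X$ such that $\|u_k-u\|_{h}\to 0$ as $k\to\infty$. -/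

import Mathlib

open Filter Topology
open scoped InnerProductSpace ComplexOrder

noncomputable section

/-! ### Sesquilinear forms in a complex inner product space

As everywhere in Mathlib, inner products and sesquilinear forms are conjugate-linear in the first
and linear in the second argument. -/

/-- A sesquilinear form in `E`, defined on a linear subspace of `E`. -/
structure SesqForm (E : Type*) [NormedAddCommGroup E] [InnerProductSpace ℂ E] where
  domain : Submodule ℂ E
  form : domain →ₗ⋆[ℂ] domain →ₗ[ℂ] ℂ

namespace SesqForm

variable {E : Type*} [NormedAddCommGroup E] [InnerProductSpace ℂ E]

/-- The form `(u, v) ↦ ⟪u, T v⟫` on the domain of an operator `T`. -/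
def ofOperator (T : E →ₗ.[ℂ] E) : SesqForm E where
  domain := T.domain
  form := LinearMap.mk₂'ₛₗ (starRingEnd ℂ) (RingHom.id ℂ) (fun u v => ⟪(u : E), T v⟫_ℂ)
    (fun u v w => by simp)
    (fun c u v => by simp [mul_comm])
    (fun u v w => by simp [LinearPMap.map_add])
    (fun c u v => by simp [LinearPMap.map_smul])

/-- The quadratic form of `t` (for a Hermitian form, `t u u` is real). -/
def quad (t : SesqForm E) (u : t.domain) : ℝ := (t.form u u).re

def IsHermitian (t : SesqForm E) : Prop :=
  ∀ u v : t.domain, t.form u v = starRingEnd ℂ (t.form v u)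

def IsLowerSemibounded (t : SesqForm E) : Prop :=
  ∃ C : ℝ, ∀ u : t.domain, C * ‖(u : E)‖ ^ 2 ≤ t.quad u

/-- The largest lower bound `λ₀` of the form. -/
def lowerBound (t : SesqForm E) : ℝ :=
  sSup {C : ℝ | ∀ u : t.domain, C * ‖(u : E)‖ ^ 2 ≤ t.quad u}

/-- The form norm `‖u‖_t`, with `‖u‖_t ^ 2 = t(u) + (β - λ₀) ‖u‖ ^ 2`, for a parameter `β > 0`. -/
def formNorm (t : SesqForm E) (β : ℝ) (u : t.domain) : ℝ :=
  √(t.quad u + (β - t.lowerBound) * ‖(u : E)‖ ^ 2)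

/-- Closedness: if `s n → u` in `E` and `t(s n - s m) → 0`, then `u` is in the domain and
`t(s n - u) → 0`. -/
def IsClosed (t : SesqForm E) : Prop :=
  ∀ (s : ℕ → t.domain) (u : E), Tendsto (fun n => (s n : E)) atTop (𝓝 u) →
    Tendsto (fun p : ℕ × ℕ => t.quad (s p.1 - s p.2)) atTop (𝓝 0) →
    ∃ v : t.domain, (v : E) = u ∧ Tendsto (fun n => t.quad (s n - v)) atTop (𝓝 0)

/-- `c` is an extension of `t`. -/
def Extends (c t : SesqForm E) : Prop :=
  ∃ h : t.domain ≤ c.domain, ∀ u v : t.domain,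
    c.form (Submodule.inclusion h u) (Submodule.inclusion h v) = t.form u v

/-- `c` is the closure of `t`: a closed, Hermitian, lower semi-bounded extension of `t` for which
the domain of `t` is a core. There is at most one such `c`. -/
structure IsClosureOf (c t : SesqForm E) : Prop where
  isHermitian : c.IsHermitian
  isLowerSemibounded : c.IsLowerSemibounded
  isClosed : c.IsClosed
  extends_form : c.Extends t
  core : ∀ u : c.domain, ∃ s : ℕ → c.domain, (∀ n, (s n : E) ∈ t.domain) ∧
    Tendsto (fun n => (s n : E)) atTop (𝓝 (u : E)) ∧
    Tendsto (fun n => c.quad (s n - u)) atTop (𝓝 0)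

open Classical in
/-- The closure of a closable form (and `t` itself if `t` is not closable). -/
def closure (t : SesqForm E) : SesqForm E :=
  if h : ∃ c : SesqForm E, c.IsClosureOf t then h.choose else t

/-- The graph of the operator associated with a form: all `(u, w)` with `u` in the form domain and
`t v u = ⟪v, w⟫` for all `v` in the form domain. -/
def operatorGraph (t : SesqForm E) : Submodule ℂ (E × E) where
  carrier := {p | ∃ u : t.domain, (u : E) = p.1 ∧ ∀ v : t.domain, t.form v u = ⟪(v : E), p.2⟫_ℂ}
  add_mem' := by
    rintro p q ⟨u, hu, hp⟩ ⟨v, hv, hq⟩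
    exact ⟨u + v, by simp [hu, hv], fun w => by simp [hp, hq]⟩
  zero_mem' := ⟨0, by simp, fun w => by simp⟩
  smul_mem' := by
    rintro c p ⟨u, hu, hp⟩
    exact ⟨c • u, by simp [hu], fun w => by simp [hp]⟩

/-- The operator associated with a (densely defined) form. -/
def operator (t : SesqForm E) : E →ₗ.[ℂ] E := t.operatorGraph.toLinearPMap

/-- For a densely defined form the graph of the associated operator is `operatorGraph`. -/
theorem operator_graph (t : SesqForm E) (ht : Dense (t.domain : Set E)) :
    t.operator.graph = t.operatorGraph := by
  refine Submodule.toLinearPMap_graph_eq _ ?_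
  rintro ⟨x, y⟩ ⟨u, hu, h⟩ hx
  have hu0 : u = 0 := Subtype.ext (by simpa using hu.trans hx)
  refine ht.eq_zero_of_inner_right (𝕜 := ℂ) fun v hv => ?_
  rw [← h ⟨v, hv⟩, hu0, map_zero]

/-- `t` is the densely defined, Hermitian, lower semi-bounded and closed form whose associated
operator is `A`. There is at most one such `t`; its domain is the form domain of `A`. -/
structure IsFormOf (t : SesqForm E) (A : E →ₗ.[ℂ] E) : Prop where
  dense : Dense (t.domain : Set E)
  isHermitian : t.IsHermitian
  isLowerSemibounded : t.IsLowerSemibounded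
  isClosed : t.IsClosed
  operator_eq : t.operator = A

end SesqForm

/-- The Friedrichs extension of a densely defined, symmetric, lower semi-bounded operator `T`: the
operator associated with the closure of the form `⟪u, T v⟫` on the domain of `T`. -/
def friedrichsExtension {E : Type*} [NormedAddCommGroup E] [InnerProductSpace ℂ E]
    (T : E →ₗ.[ℂ] E) : E →ₗ.[ℂ] E :=
  (SesqForm.ofOperator T).closure.operator

/-! ### Weighted graphs -/

/-- A symmetric weighted graph with vertex set `X`, edge weight `b` and vertex weight `μ`. -/
structure WeightedGraph (X : Type*) where
  b : X → X → ℝ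
  b_nonneg : ∀ x y, 0 ≤ b x y
  b_symm : ∀ x y, b x y = b y x
  b_self : ∀ x, b x x = 0
  b_summable : ∀ x, Summable (b x)
  μ : X → ℝ
  μ_pos : ∀ x, 0 < μ x

namespace WeightedGraph

variable {X : Type*} (G : WeightedGraph X)

/-- The line `ℂ` over the vertex `x`, with the inner product `μ(x) * conj z * w`. -/
def Fiber (_ : WeightedGraph X) (_ : X) : Type := ℂ

abbrev fiberCore (x : X) : InnerProductSpace.Core ℂ ℂ where
  inner z w := (G.μ x : ℂ) * (starRingEnd ℂ z * w)
  conj_inner_symm z w := by simp [mul_comm]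
  re_inner_nonneg z := by
    have h := mul_nonneg (G.μ_pos x).le (Complex.normSq_nonneg z)
    rw [← Complex.normSq_eq_conj_mul_self, ← Complex.ofReal_mul]
    simpa using h
  add_left z w v := by simp; ring
  smul_left z w c := by simp; ring
  definite z h := by
    have := (G.μ_pos x).ne'
    simpa [this] using h

instance fiberNormedAddCommGroup (x : X) : NormedAddCommGroup (G.Fiber x) :=
  @InnerProductSpace.Core.toNormedAddCommGroup ℂ ℂ _ _ _ (G.fiberCore x)

instance fiberInnerProductSpace (x : X) : InnerProductSpace ℂ (G.Fiber x) :=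
  @InnerProductSpace.ofCore ℂ ℂ _ _ _ (G.fiberCore x).toCore

instance fiberFiniteDimensional (x : X) : FiniteDimensional ℂ (G.Fiber x) :=
  inferInstanceAs (FiniteDimensional ℂ ℂ)

instance fiberCompleteSpace (x : X) : CompleteSpace (G.Fiber x) :=
  FiniteDimensional.complete ℂ (G.Fiber x)

/-- A function `X → ℂ`, with its values seen in the fibers. -/
def lift (f : X → ℂ) (x : X) : G.Fiber x := f x

/-- The Hilbert space `ℓ²(X, μ)` of all `f : X → ℂ` with `∑ μ(x) |f(x)|² < ∞`. -/
abbrev L2 : Type _ := lp (fun x => G.Fiber x) 2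

variable {G}

/-- An element of `ℓ²(X, μ)` as a function. -/
def L2.fn (u : G.L2) (x : X) : ℂ := u x

theorem norm_lift_sq (f : X → ℂ) (x : X) : ‖G.lift f x‖ ^ 2 = G.μ x * ‖f x‖ ^ 2 := by
  have h : ‖G.lift f x‖ ^ 2 = (⟪G.lift f x, G.lift f x⟫_ℂ).re :=
    norm_sq_eq_re_inner (𝕜 := ℂ) (G.lift f x)
  rw [h]
  change ((G.μ x : ℂ) * (starRingEnd ℂ (f x) * f x)).re = _
  rw [← Complex.normSq_eq_conj_mul_self, ← Complex.ofReal_mul, Complex.ofReal_re,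
    Complex.normSq_eq_norm_sq]

/-- Membership in `ℓ²(X, μ)` means `∑ μ(x) |f(x)|² < ∞`. -/
theorem memℓp_lift_iff (f : X → ℂ) :
    Memℓp (G.lift f) 2 ↔ Summable fun x => G.μ x * ‖f x‖ ^ 2 := by
  rw [memℓp_gen_iff (by norm_num)]
  refine summable_congr fun x => ?_
  simpa using norm_lift_sq (G := G) f x

/-- The inner product of `ℓ²(X, μ)`. -/
theorem inner_eq (u v : G.L2) :
    ⟪u, v⟫_ℂ = ∑' x, (G.μ x : ℂ) * (starRingEnd ℂ (u.fn x) * v.fn x) :=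
  lp.inner_eq_tsum u v

variable (G)

/-- The finitely supported functions, as a subspace of `ℓ²(X, μ)`. -/
def Cc : Submodule ℂ G.L2 where
  carrier := {u | (Function.support u.fn).Finite}
  add_mem' {u v} hu hv := (hu.union hv).subset (Function.support_add u.fn v.fn)
  zero_mem' := by
    have : (L2.fn (0 : G.L2)) = 0 := rfl
    simp [this]
  smul_mem' c u hu := hu.subset (Function.support_const_smul_subset c u.fn)

/-- The finiteness condition: `y ↦ b(x,y) / μ(y)` belongs to `ℓ²(X, μ)` for every vertex `x`. -/
def FinitenessCondition : Prop :=
  ∀ x, Summable fun y => G.μ y * (G.b x y / G.μ y) ^ 2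

/-- The formal Schrödinger operator with potential `V`. It is meant for those `f` for which all
the sums `∑ y, b(x,y) |f(y)|` are finite, in particular for all finitely supported `f`. -/
def formalSchrodinger (V : X → ℝ) (f : X → ℂ) (x : X) : ℂ :=
  1 / (G.μ x : ℂ) * ∑' y, (G.b x y : ℂ) * (f x - f y) + (V x : ℂ) * f x


variable {G}

theorem summable_of_finite_support {f : X → ℂ} (hf : (Function.support f).Finite) (x : X) :
    Summable fun y => (G.b x y : ℂ) * (f x - f y) := by
  have h1 : Summable fun y => (G.b x y : ℂ) * f x :=
    (Complex.ofRealCLM.summable (G.b_summable x)).mul_right _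
  have h2 : Summable fun y => (G.b x y : ℂ) * f y :=
    summable_of_hasFiniteSupport (hf.subset fun y hy => by
      simp only [Function.mem_support] at hy ⊢
      exact right_ne_zero_of_mul hy)
  simpa [mul_sub] using h1.sub h2

theorem formalSchrodinger_eq (V : X → ℝ) {f : X → ℂ} (hf : (Function.support f).Finite) (x : X) :
    G.formalSchrodinger V f x =
      (1 / (G.μ x : ℂ) * (∑' y, (G.b x y : ℂ)) + (V x : ℂ)) * f x
        - ∑ y ∈ hf.toFinset, f y * ((G.b y x / G.μ x : ℝ) : ℂ) := by
  have h1 : Summable fun y => (G.b x y : ℂ) := Complex.ofRealCLM.summable (G.b_summable x)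
  have h2 : HasSum (fun y => (G.b x y : ℂ) * f y) (∑ y ∈ hf.toFinset, (G.b x y : ℂ) * f y) :=
    hasSum_sum_of_ne_finset_zero fun y hy => by
      have : f y = 0 := by simpa using hy
      simp [this]
  have h3 : ∑' y, (G.b x y : ℂ) * (f x - f y) =
      (∑' y, (G.b x y : ℂ)) * f x - ∑ y ∈ hf.toFinset, (G.b x y : ℂ) * f y := by
    simpa [mul_sub] using ((h1.hasSum.mul_right (f x)).sub h2).tsum_eq
  have h4 : ∑ y ∈ hf.toFinset, f y * ((G.b y x / G.μ x : ℝ) : ℂ) =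
      1 / (G.μ x : ℂ) * ∑ y ∈ hf.toFinset, (G.b x y : ℂ) * f y := by
    rw [Finset.mul_sum]
    refine Finset.sum_congr rfl fun y _ => ?_
    rw [G.b_symm y x]
    push_cast
    ring
  rw [formalSchrodinger, h3, h4]
  ring

/-- Under the finiteness condition the Schrödinger operator maps finitely supported functions
into `ℓ²(X, μ)`. -/
theorem memℓp_formalSchrodinger (hG : G.FinitenessCondition) (V : X → ℝ) {f : X → ℂ}
    (hf : (Function.support f).Finite) :
    Memℓp (G.lift (G.formalSchrodinger V f)) 2 := by
  have h1 : Memℓp (G.lift fun x =>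
      (1 / (G.μ x : ℂ) * (∑' y, (G.b x y : ℂ)) + (V x : ℂ)) * f x) 2 := by
    rw [memℓp_lift_iff]
    refine summable_of_hasFiniteSupport (hf.subset fun y hy => ?_)
    simp only [Function.mem_support] at hy ⊢
    rintro h
    simp [h] at hy
  have h2 : ∀ y, Memℓp (G.lift fun x => f y * ((G.b y x / G.μ x : ℝ) : ℂ)) 2 := by
    intro y
    rw [memℓp_lift_iff]
    refine ((hG y).mul_left (‖f y‖ ^ 2)).congr fun x => ?_
    rw [norm_mul, Complex.norm_real, mul_pow, Real.norm_eq_abs, sq_abs]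
    ring
  have h3 := h1.sub (Memℓp.finsetSum hf.toFinset fun y _ => h2 y)
  have h4 : G.lift (G.formalSchrodinger V f) = _ :=
    funext fun x => formalSchrodinger_eq V hf x
  rw [h4]
  exact h3

/-- The Schrödinger operator with potential `V`, as an operator in `ℓ²(X, μ)` whose domain
consists of the finitely supported functions. -/
def schrodinger (hG : G.FinitenessCondition) (V : X → ℝ) : G.L2 →ₗ.[ℂ] G.L2 where
  domain := G.Cc
  toFun :=
    { toFun := fun u => ⟨G.lift (G.formalSchrodinger V (L2.fn u.1)),
        memℓp_formalSchrodinger hG V u.2⟩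
      map_add' := fun u v => by
        apply lp.ext
        funext x
        have hu := summable_of_finite_support (G := G) u.2 x
        have hv := summable_of_finite_support (G := G) v.2 x
        change G.formalSchrodinger V (fun x => L2.fn u.1 x + L2.fn v.1 x) x =
          G.formalSchrodinger V (L2.fn u.1) x + G.formalSchrodinger V (L2.fn v.1) x
        have h : ∑' y, (G.b x y : ℂ) *
            ((L2.fn u.1 x + L2.fn v.1 x) - (L2.fn u.1 y + L2.fn v.1 y)) =
            ∑' y, (G.b x y : ℂ) * (L2.fn u.1 x - L2.fn u.1 y) +
              ∑' y, (G.b x y : ℂ) * (L2.fn v.1 x - L2.fn v.1 y) := by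
          rw [← hu.tsum_add hv]
          exact tsum_congr fun y => by ring
        simp only [formalSchrodinger, h]
        ring
      map_smul' := fun c u => by
        apply lp.ext
        funext x
        change G.formalSchrodinger V (fun x => c * L2.fn u.1 x) x =
          c * G.formalSchrodinger V (L2.fn u.1) x
        have h : ∑' y, (G.b x y : ℂ) * (c * L2.fn u.1 x - c * L2.fn u.1 y) =
            c * ∑' y, (G.b x y : ℂ) * (L2.fn u.1 x - L2.fn u.1 y) := by
          rw [← tsum_mul_left]
          exact tsum_congr fun y => by ring
        simp only [formalSchrodinger, h]
        ring }

/-- An operator `A` in `ℓ²(X, μ)` has a positive form core: every non-negative `u` in its form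
domain is the limit, in the form norm, of non-negative finitely supported functions. -/
def HasPositiveFormCore (A : G.L2 →ₗ.[ℂ] G.L2) : Prop :=
  ∃ t : SesqForm G.L2, t.IsFormOf A ∧
    ∀ u : t.domain, (∀ x, 0 ≤ L2.fn u.1 x) →
      ∃ s : ℕ → t.domain, (∀ k, (s k : G.L2) ∈ G.Cc ∧ ∀ x, 0 ≤ L2.fn (s k).1 x) ∧
        ∀ β : ℝ, 0 < β → Tendsto (fun k => t.formNorm β (s k - u)) atTop (𝓝 0)

end WeightedGraph

end

/-! Let `s k → u` in the form norm with `s k` finitely supported and `u ≥ 0`. The candidates are the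
absolute values `|s k|`. They converge to `u` in `ℓ²` because `||s k| - u| ≤ |s k - u|`, and passing
to the absolute value does not increase the form, so the form norms of the `|s k|` are bounded by a
sequence that tends to the form norm of `u`. In the Hilbert space of a closed form these two facts
imply weak convergence and then strong convergence. The same Hilbert space, completed, provides the
closure of the form of a symmetric lower semi-bounded operator. -/

noncomputable section

section HilbertSpace

variable {𝕜 H E : Type*} [RCLike 𝕜]
  [NormedAddCommGroup H] [InnerProductSpace 𝕜 H] [CompleteSpace H]
  [NormedAddCommGroup E] [InnerProductSpace 𝕜 E] [CompleteSpace E]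

theorem denseRange_adjoint_of_injective {j : H →L[𝕜] E} (hj : Function.Injective j) :
    DenseRange (ContinuousLinearMap.adjoint j) := by
  have h : (ContinuousLinearMap.adjoint j).rangeᗮ = ⊥ := by
    rw [ContinuousLinearMap.orthogonal_range, ContinuousLinearMap.adjoint_adjoint]
    exact LinearMap.ker_eq_bot.2 hj
  exact Submodule.dense_iff_topologicalClosure_eq_top.2
    (Submodule.topologicalClosure_eq_top_iff.2 h)

theorem tendsto_of_tendsto_map_of_norm_sq_le {ι : Type*} {l : Filter ι} {j : H →L[𝕜] E}
    (hj : Function.Injective j) {a : ι → H} {u : H} {r : ι → ℝ}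
    (ha : Tendsto (fun i => j (a i)) l (𝓝 (j u))) (hr : Tendsto r l (𝓝 (‖u‖ ^ 2)))
    (hle : ∀ i, ‖a i‖ ^ 2 ≤ r i) : Tendsto a l (𝓝 u) := by
  rw [Metric.tendsto_nhds]
  intro ε hε
  obtain ⟨y, hy⟩ := (denseRange_adjoint_of_injective hj).exists_dist_lt u (half_pos hε)
  set w := ContinuousLinearMap.adjoint j y
  -- Against `w = j† y` the inner products already converge, and such `w` are dense.
  have hlim : Tendsto (fun i => r i - 2 * RCLike.re (inner 𝕜 (j (a i)) y) + ‖w‖ ^ 2) l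
      (𝓝 (‖u - w‖ ^ 2)) := by
    rw [norm_sub_sq (𝕜 := 𝕜), ContinuousLinearMap.adjoint_inner_right]
    have hinner := (RCLike.continuous_re.tendsto _).comp
      (ha.inner (𝕜 := 𝕜) (tendsto_const_nhds (x := y)))
    exact (hr.sub (hinner.const_mul 2)).add_const _
  have hlt : ‖u - w‖ ^ 2 < (ε / 2) ^ 2 := by
    rw [← dist_eq_norm]
    gcongr
  filter_upwards [hlim.eventually_lt_const hlt] with i hi
  have haw : dist (a i) w < ε / 2 := by
    rw [dist_eq_norm]
    refine lt_of_pow_lt_pow_left₀ 2 (half_pos hε).le (lt_of_le_of_lt ?_ hi)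
    rw [norm_sub_sq (𝕜 := 𝕜), ContinuousLinearMap.adjoint_inner_right]
    gcongr
    exact hle i
  linarith [dist_triangle_right (a i) u w]

end HilbertSpace

namespace SesqForm

variable {E : Type*} [NormedAddCommGroup E] [InnerProductSpace ℂ E]

theorem re_ofReal_mul_inner_self (k : ℝ) (x : E) : ((k : ℂ) * ⟪x, x⟫_ℂ).re = k * ‖x‖ ^ 2 := by
  rw [Complex.re_ofReal_mul, norm_sq_eq_re_inner (𝕜 := ℂ) x, RCLike.re_eq_complex_re]

section FormSpace

variable {t : SesqForm E} {C : ℝ}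

/-- The inner product `t(u, v) + (1 - C) ⟪u, v⟫` on the domain of a Hermitian form `t` with lower
bound `C`. The shift by `1 - C` makes its norm dominate the norm of `E`. -/
abbrev formCore (ht : t.IsHermitian) (hC : ∀ u : t.domain, C * ‖(u : E)‖ ^ 2 ≤ t.quad u) :
    InnerProductSpace.Core ℂ t.domain where
  inner u v := t.form u v + ((1 - C : ℝ) : ℂ) * ⟪(u : E), (v : E)⟫_ℂ
  conj_inner_symm u v := by
    rw [map_add, map_mul, ← ht u v, inner_conj_symm, Complex.conj_ofReal]
  re_inner_nonneg u := by
    change 0 ≤ (t.form u u + ((1 - C : ℝ) : ℂ) * ⟪(u : E), (u : E)⟫_ℂ).re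
    rw [Complex.add_re, re_ofReal_mul_inner_self]
    have : 0 ≤ ‖(u : E)‖ ^ 2 := by positivity
    have := hC u
    unfold quad at this
    linarith
  add_left u v w := by
    simp only [map_add, LinearMap.add_apply, Submodule.coe_add, inner_add_left]
    ring
  smul_left u v c := by
    simp only [map_smulₛₗ, LinearMap.smul_apply, Submodule.coe_smul, inner_smul_left, smul_eq_mul]
    ring
  definite u hu := by
    have hre := congrArg Complex.re hu
    rw [Complex.add_re, re_ofReal_mul_inner_self, Complex.zero_re] at hre
    have h := hC u
    unfold quad at h
    have hu0 : ‖(u : E)‖ ^ 2 = 0 := le_antisymm (by linarith) (sq_nonneg _)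
    simpa using hu0

/-- The domain of a Hermitian form `t` with lower bound `C`, as a pre-Hilbert space with the inner
product `formCore`. It is a type synonym, since `t.domain` carries the inner product of `E`. -/
def FormSpace (_ : t.IsHermitian) (_ : ∀ u : t.domain, C * ‖(u : E)‖ ^ 2 ≤ t.quad u) : Type _ :=
  t.domain

variable (ht : t.IsHermitian) (hC : ∀ u : t.domain, C * ‖(u : E)‖ ^ 2 ≤ t.quad u)

instance : NormedAddCommGroup (FormSpace ht hC) :=
  @InnerProductSpace.Core.toNormedAddCommGroup ℂ t.domain _ _ _ (formCore ht hC)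

instance : InnerProductSpace ℂ (FormSpace ht hC) :=
  @InnerProductSpace.ofCore ℂ t.domain _ _ _ (formCore ht hC).toCore

-- With `ComplexOrder` open, instance search finds the inner product through `CStarModule` first.
instance : Inner ℂ (FormSpace ht hC) := InnerProductSpace.toInner

/-- The identity map from the domain of a form to its pre-Hilbert space. -/
def toFormSpace : t.domain ≃ₗ[ℂ] FormSpace ht hC := LinearEquiv.refl ℂ t.domain

theorem inner_toFormSpace (u v : t.domain) :
    ⟪toFormSpace ht hC u, toFormSpace ht hC v⟫_ℂ =
      t.form u v + ((1 - C : ℝ) : ℂ) * ⟪(u : E), (v : E)⟫_ℂ := rfl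

theorem norm_toFormSpace_sq (u : t.domain) :
    ‖toFormSpace ht hC u‖ ^ 2 = t.quad u + (1 - C) * ‖(u : E)‖ ^ 2 := by
  rw [norm_sq_eq_re_inner (𝕜 := ℂ), inner_toFormSpace, RCLike.re_eq_complex_re, Complex.add_re,
    re_ofReal_mul_inner_self, quad]

theorem norm_le_norm_toFormSpace (u : t.domain) : ‖(u : E)‖ ≤ ‖toFormSpace ht hC u‖ := by
  refine le_of_sq_le_sq ?_ (norm_nonneg _)
  rw [norm_toFormSpace_sq]
  linarith [hC u]

theorem tendsto_toFormSpace_zero_iff {ι : Type*} {l : Filter ι} {w : ι → t.domain} :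
    Tendsto (fun i => ‖toFormSpace ht hC (w i)‖) l (𝓝 0) ↔
      Tendsto (fun i => ‖(w i : E)‖) l (𝓝 0) ∧ Tendsto (fun i => t.quad (w i)) l (𝓝 0) := by
  constructor
  · intro h
    have hE : Tendsto (fun i => ‖(w i : E)‖) l (𝓝 0) :=
      squeeze_zero (fun _ => norm_nonneg _) (fun i => norm_le_norm_toFormSpace ht hC (w i)) h
    refine ⟨hE, ?_⟩
    simpa [norm_toFormSpace_sq] using (h.pow 2).sub ((hE.pow 2).const_mul (1 - C))
  · rintro ⟨hE, hq⟩
    have hsq : Tendsto (fun i => ‖toFormSpace ht hC (w i)‖ ^ 2) l (𝓝 0) := by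
      simpa [norm_toFormSpace_sq] using hq.add ((hE.pow 2).const_mul (1 - C))
    simpa using hsq.sqrt

theorem tendsto_toFormSpace_iff {ι : Type*} {l : Filter ι} {s : ι → t.domain} {u : t.domain} :
    Tendsto (fun i => toFormSpace ht hC (s i)) l (𝓝 (toFormSpace ht hC u)) ↔
      Tendsto (fun i => (s i : E)) l (𝓝 (u : E)) ∧
        Tendsto (fun i => t.quad (s i - u)) l (𝓝 0) := by
  rw [tendsto_iff_norm_sub_tendsto_zero, tendsto_iff_norm_sub_tendsto_zero (b := (u : E))]
  simpa using tendsto_toFormSpace_zero_iff ht hC (l := l) (w := fun i => s i - u)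

theorem cauchySeq_toFormSpace_iff {s : ℕ → t.domain} :
    CauchySeq (fun n => toFormSpace ht hC (s n)) ↔
      CauchySeq (fun n => (s n : E)) ∧
        Tendsto (fun p : ℕ × ℕ => t.quad (s p.1 - s p.2)) atTop (𝓝 0) := by
  simp only [cauchySeq_iff_tendsto_dist_atTop_0, dist_eq_norm]
  simpa using tendsto_toFormSpace_zero_iff ht hC (l := atTop)
    (w := fun p : ℕ × ℕ => s p.1 - s p.2)

/-- The inclusion of the pre-Hilbert space of a form in `E`. -/
def formInclusion : FormSpace ht hC →L[ℂ] E :=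
  LinearMap.mkContinuous (t.domain.subtype ∘ₗ ((toFormSpace ht hC).symm : _ →ₗ[ℂ] t.domain)) 1
    fun u => by simpa using norm_le_norm_toFormSpace ht hC ((toFormSpace ht hC).symm u)

@[simp]
theorem formInclusion_toFormSpace (u : t.domain) :
    formInclusion ht hC (toFormSpace ht hC u) = u := rfl

theorem formInclusion_injective : Function.Injective (formInclusion ht hC) :=
  Subtype.val_injective

theorem IsClosed.completeSpace_formSpace [CompleteSpace E] (htc : t.IsClosed) :
    CompleteSpace (FormSpace ht hC) := by
  refine Metric.complete_of_cauchySeq_tendsto fun (s : ℕ → t.domain) hs => ?_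
  obtain ⟨hE, hq⟩ := (cauchySeq_toFormSpace_iff ht hC).1 hs
  obtain ⟨x, hx⟩ := cauchySeq_tendsto_of_complete hE
  obtain ⟨u, rfl, hu⟩ := htc s x hx hq
  exact ⟨toFormSpace ht hC u, (tendsto_toFormSpace_iff ht hC).2 ⟨hx, hu⟩⟩

end FormSpace

section Convergence

variable {t : SesqForm E} {ι : Type*} {l : Filter ι} {s : ι → t.domain} {u : t.domain}

theorem tendsto_quad (ht : t.IsHermitian) (hb : t.IsLowerSemibounded)
    (hs : Tendsto (fun i => (s i : E)) l (𝓝 (u : E)))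
    (hq : Tendsto (fun i => t.quad (s i - u)) l (𝓝 0)) :
    Tendsto (fun i => t.quad (s i)) l (𝓝 (t.quad u)) := by
  obtain ⟨C, hC⟩ := hb
  have h := (((tendsto_toFormSpace_iff ht hC).2 ⟨hs, hq⟩).norm.pow 2).sub
    ((hs.norm.pow 2).const_mul (1 - C))
  simpa [norm_toFormSpace_sq] using h

theorem IsClosed.tendsto_quad_sub_of_quad_le [CompleteSpace E] (htc : t.IsClosed)
    (ht : t.IsHermitian) (hb : t.IsLowerSemibounded) {r : ι → ℝ}
    (hs : Tendsto (fun i => (s i : E)) l (𝓝 (u : E))) (hr : Tendsto r l (𝓝 (t.quad u)))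
    (hle : ∀ i, t.quad (s i) ≤ r i) :
    Tendsto (fun i => t.quad (s i - u)) l (𝓝 0) := by
  obtain ⟨C, hC⟩ := hb
  have := htc.completeSpace_formSpace ht hC
  have hnorm : Tendsto (fun i => r i + (1 - C) * ‖(s i : E)‖ ^ 2) l
      (𝓝 (‖toFormSpace ht hC u‖ ^ 2)) := by
    rw [norm_toFormSpace_sq]
    exact hr.add ((hs.norm.pow 2).const_mul (1 - C))
  refine ((tendsto_toFormSpace_iff ht hC).1 (tendsto_of_tendsto_map_of_norm_sq_le
    (formInclusion_injective ht hC) (by simpa using hs) hnorm fun i => ?_)).2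
  rw [norm_toFormSpace_sq]
  gcongr
  exact hle i

theorem tendsto_formNorm_sub (hs : Tendsto (fun i => (s i : E)) l (𝓝 (u : E)))
    (hq : Tendsto (fun i => t.quad (s i - u)) l (𝓝 0)) (β : ℝ) :
    Tendsto (fun i => t.formNorm β (s i - u)) l (𝓝 0) := by
  have hsq : Tendsto (fun i => ‖((s i - u : t.domain) : E)‖ ^ 2) l (𝓝 0) := by
    simpa using (tendsto_iff_norm_sub_tendsto_zero.1 hs).pow 2
  simpa [formNorm] using (hq.add (hsq.const_mul (β - t.lowerBound))).sqrt

end Convergence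

section OfEmbedding

variable {H : Type*} [NormedAddCommGroup H] [InnerProductSpace ℂ H]

/-- The form on the range of an injective map `j : H → E` which corresponds to the inner product
of `H`, minus `k` times the inner product of `E`. -/
def ofEmbedding (j : H →L[ℂ] E) (hj : Function.Injective j) (k : ℝ) : SesqForm E where
  domain := (j : H →ₗ[ℂ] E).range
  form :=
    let e := (LinearEquiv.ofInjective (j : H →ₗ[ℂ] E) hj).symm
    LinearMap.mk₂'ₛₗ (starRingEnd ℂ) (RingHom.id ℂ)
      (fun u v => ⟪e u, e v⟫_ℂ - k * ⟪(u : E), (v : E)⟫_ℂ)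
      (fun u v w => by
        simp only [map_add, inner_add_left, Submodule.coe_add]
        ring)
      (fun c u v => by
        simp only [map_smul, inner_smul_left, Submodule.coe_smul, smul_eq_mul]
        ring)
      (fun u v w => by
        simp only [map_add, inner_add_right, Submodule.coe_add]
        ring)
      (fun c u v => by
        simp only [map_smul, inner_smul_right, Submodule.coe_smul, smul_eq_mul, RingHom.id_apply]
        ring)

variable (j : H →L[ℂ] E) (hj : Function.Injective j) (k : ℝ)

/-- The identification of `H` with the domain of the form `ofEmbedding`. -/
def embed : H ≃ₗ[ℂ] (ofEmbedding j hj k).domain :=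
  LinearEquiv.ofInjective (j : H →ₗ[ℂ] E) hj

@[simp]
theorem coe_embed (f : H) : (embed j hj k f : E) = j f := rfl

theorem ofEmbedding_form (f g : H) :
    (ofEmbedding j hj k).form (embed j hj k f) (embed j hj k g) =
      ⟪f, g⟫_ℂ - k * ⟪j f, j g⟫_ℂ := by
  change ⟪(embed j hj k).symm (embed j hj k f), (embed j hj k).symm (embed j hj k g)⟫_ℂ - _ = _
  simp only [LinearEquiv.symm_apply_apply, coe_embed]

theorem ofEmbedding_quad (f : H) :
    (ofEmbedding j hj k).quad (embed j hj k f) = ‖f‖ ^ 2 - k * ‖j f‖ ^ 2 := by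
  rw [quad, ofEmbedding_form, Complex.sub_re, re_ofReal_mul_inner_self,
    norm_sq_eq_re_inner (𝕜 := ℂ) f, RCLike.re_eq_complex_re]

theorem ofEmbedding_isHermitian : (ofEmbedding j hj k).IsHermitian := by
  intro u v
  obtain ⟨f, rfl⟩ := (embed j hj k).surjective u
  obtain ⟨g, rfl⟩ := (embed j hj k).surjective v
  simp [ofEmbedding_form]

theorem ofEmbedding_isLowerSemibounded : (ofEmbedding j hj k).IsLowerSemibounded := by
  refine ⟨-k, fun u => ?_⟩
  obtain ⟨f, rfl⟩ := (embed j hj k).surjective u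
  rw [ofEmbedding_quad, coe_embed]
  linarith [sq_nonneg ‖f‖]

variable {j k} in
theorem tendsto_ofEmbedding_quad_sub {ι : Type*} {l : Filter ι} {f : ι → H} {g : H}
    (h : Tendsto f l (𝓝 g)) :
    Tendsto (fun i => (ofEmbedding j hj k).quad (embed j hj k (f i) - embed j hj k g)) l
      (𝓝 0) := by
  simp only [← map_sub, ofEmbedding_quad]
  have hcont : Continuous fun w : H => ‖w - g‖ ^ 2 - k * ‖j (w - g)‖ ^ 2 := by fun_prop
  simpa [Function.comp_def] using (hcont.tendsto g).comp h

theorem ofEmbedding_isClosed [CompleteSpace H] : (ofEmbedding j hj k).IsClosed := by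
  intro s u hs hq
  obtain ⟨f, rfl⟩ := (embed j hj k).surjective.comp_left s
  simp only [Function.comp_apply, coe_embed, ← map_sub, ofEmbedding_quad] at hs hq
  have hjf : Tendsto (fun p : ℕ × ℕ => ‖j (f p.1 - f p.2)‖) atTop (𝓝 0) := by
    simpa [dist_eq_norm] using cauchySeq_iff_tendsto_dist_atTop_0.1 hs.cauchySeq
  have hf : CauchySeq f := by
    rw [cauchySeq_iff_tendsto_dist_atTop_0]
    simpa [dist_eq_norm] using (hq.add ((hjf.pow 2).const_mul k)).sqrt
  obtain ⟨g, hg⟩ := cauchySeq_tendsto_of_complete hf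
  have hjg : Tendsto (fun n => j (f n)) atTop (𝓝 (j g)) := (j.continuous.tendsto g).comp hg
  exact ⟨embed j hj k g, tendsto_nhds_unique hjg hs, tendsto_ofEmbedding_quad_sub hj hg⟩

variable {j k} in
theorem ofEmbedding_isClosureOf [CompleteSpace H] {t : SesqForm E} {i : t.domain → H}
    (hi : DenseRange i) (hji : ∀ u, j (i u) = u)
    (hform : ∀ u v, t.form u v = ⟪i u, i v⟫_ℂ - k * ⟪(u : E), (v : E)⟫_ℂ) :
    (ofEmbedding j hj k).IsClosureOf t where
  isHermitian := ofEmbedding_isHermitian j hj k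
  isLowerSemibounded := ofEmbedding_isLowerSemibounded j hj k
  isClosed := ofEmbedding_isClosed j hj k
  extends_form := by
    have hle : t.domain ≤ (ofEmbedding j hj k).domain := fun x hx => ⟨i ⟨x, hx⟩, hji ⟨x, hx⟩⟩
    have hincl : ∀ u, Submodule.inclusion hle u = embed j hj k (i u) :=
      fun u => Subtype.ext (hji u).symm
    refine ⟨hle, fun u v => ?_⟩
    rw [hincl, hincl, ofEmbedding_form, hji, hji, hform]
  core u := by
    obtain ⟨f, rfl⟩ := (embed j hj k).surjective u
    obtain ⟨x, hx, hxf⟩ := mem_closure_iff_seq_limit.1 (hi f)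
    choose s hs using hx
    obtain rfl : i ∘ s = x := funext hs
    refine ⟨fun n => embed j hj k (i (s n)), fun n => ?_, (j.continuous.tendsto f).comp hxf,
      tendsto_ofEmbedding_quad_sub hj hxf⟩
    rw [coe_embed, hji]
    exact (s n).2

end OfEmbedding

section Closable

/-- Closability of a form: `s n → 0` in `E` and `t(s n - s m) → 0` imply `t(s n) → 0`. For
Hermitian, lower semi-bounded forms this is equivalent to the existence of a closure. -/
def IsClosable (t : SesqForm E) : Prop :=
  ∀ s : ℕ → t.domain, Tendsto (fun n => (s n : E)) atTop (𝓝 0) →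
    Tendsto (fun p : ℕ × ℕ => t.quad (s p.1 - s p.2)) atTop (𝓝 0) →
    Tendsto (fun n => t.quad (s n)) atTop (𝓝 0)

variable {t : SesqForm E} {C : ℝ}

section Completion

variable [CompleteSpace E]
  (ht : t.IsHermitian) (hC : ∀ u : t.domain, C * ‖(u : E)‖ ^ 2 ≤ t.quad u)

/-- The continuous extension of `formInclusion` to the Hilbert space completion. -/
def completionInclusion : UniformSpace.Completion (FormSpace ht hC) →L[ℂ] E :=
  (formInclusion ht hC).extend UniformSpace.Completion.toComplL

@[simp]
theorem completionInclusion_coe (u : FormSpace ht hC) :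
    completionInclusion ht hC (u : UniformSpace.Completion (FormSpace ht hC)) =
      formInclusion ht hC u :=
  ContinuousLinearMap.extend_eq _ UniformSpace.Completion.denseRange_coe
    (UniformSpace.Completion.isUniformInducing_coe _) u

theorem IsClosable.completionInclusion_injective (htc : t.IsClosable) :
    Function.Injective (completionInclusion ht hC) := by
  refine (injective_iff_map_eq_zero _).2 fun w hw => ?_
  obtain ⟨x, hx, hxw⟩ := mem_closure_iff_seq_limit.1 (UniformSpace.Completion.denseRange_coe w)
  choose f hf using hx
  obtain ⟨s, rfl⟩ := (toFormSpace ht hC).surjective.comp_left f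
  obtain rfl : (fun n => ((toFormSpace ht hC (s n) : FormSpace ht hC) :
      UniformSpace.Completion (FormSpace ht hC))) = x := funext hf
  have hE : Tendsto (fun n => (s n : E)) atTop (𝓝 0) := by
    simpa [hw, Function.comp_def] using
      ((completionInclusion ht hC).continuous.tendsto w).comp hxw
  have hcauchy : CauchySeq fun n => toFormSpace ht hC (s n) :=
    (UniformSpace.Completion.isUniformInducing_coe _).cauchy_map_iff.1 hxw.cauchySeq
  have hq := htc s hE ((cauchySeq_toFormSpace_iff ht hC).1 hcauchy).2
  have hnorm := (tendsto_toFormSpace_zero_iff ht hC).2 ⟨by simpa using hE.norm, hq⟩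
  have hlim := hxw.norm
  simp only [UniformSpace.Completion.norm_coe] at hlim
  exact norm_eq_zero.1 (tendsto_nhds_unique hlim hnorm)

end Completion

theorem IsClosable.exists_isClosureOf [CompleteSpace E] (htc : t.IsClosable) (ht : t.IsHermitian)
    (hb : t.IsLowerSemibounded) : ∃ c : SesqForm E, c.IsClosureOf t := by
  obtain ⟨C, hC⟩ := hb
  refine ⟨_, ofEmbedding_isClosureOf (htc.completionInclusion_injective ht hC) (k := 1 - C)
    (i := fun u => (toFormSpace ht hC u : UniformSpace.Completion (FormSpace ht hC)))
    (UniformSpace.Completion.denseRange_coe.comp (toFormSpace ht hC).surjective.denseRange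
      (UniformSpace.Completion.continuous_coe _)) (fun u => by simp) fun u v => ?_⟩
  rw [UniformSpace.Completion.inner_coe, inner_toFormSpace, add_sub_cancel_right]

theorem IsClosable.closure_isClosureOf [CompleteSpace E] (htc : t.IsClosable)
    (ht : t.IsHermitian) (hb : t.IsLowerSemibounded) : t.closure.IsClosureOf t := by
  have h := htc.exists_isClosureOf ht hb
  rw [closure, dif_pos h]
  exact h.choose_spec

end Closable

section OfOperator

variable {T : E →ₗ.[ℂ] E}

theorem ofOperator_isHermitian (hT : T.IsFormalAdjoint T) : (ofOperator T).IsHermitian :=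
  fun u v => (hT u v).symm.trans (inner_conj_symm _ _).symm

theorem ofOperator_isClosable (hT : T.IsFormalAdjoint T)
    (hb : (ofOperator T).IsLowerSemibounded) : (ofOperator T).IsClosable := by
  obtain ⟨C, hC⟩ := hb
  have ht := ofOperator_isHermitian hT
  intro s hs hq
  have hcauchy := (cauchySeq_toFormSpace_iff ht hC).2 ⟨hs.cauchySeq, hq⟩
  obtain ⟨w, hw⟩ := cauchySeq_tendsto_of_complete
    ((UniformSpace.Completion.uniformContinuous_coe _).comp_cauchySeq hcauchy)
  -- `⟪u, w⟫ = lim ⟪T u + (1 - C) u, s n⟫ = 0` for all `u` in the domain of `T`, hence `w = 0`.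
  have hinner (u : (ofOperator T).domain) :
      Tendsto (fun n => ⟪toFormSpace ht hC u, toFormSpace ht hC (s n)⟫_ℂ) atTop (𝓝 0) := by
    have hrepr (v : (ofOperator T).domain) : ⟪toFormSpace ht hC u, toFormSpace ht hC v⟫_ℂ =
        ⟪T u + ((1 - C : ℝ) : ℂ) • (u : E), (v : E)⟫_ℂ := by
      rw [inner_toFormSpace, inner_add_left, inner_smul_left, Complex.conj_ofReal, hT u v]
      rfl
    simp only [hrepr]
    have hlim := (tendsto_const_nhds (x := T u + ((1 - C : ℝ) : ℂ) • (u : E))).inner (𝕜 := ℂ) hs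
    rwa [inner_zero_right] at hlim
  have hw0 : w = 0 := by
    refine DenseRange.eq_zero_of_inner_right (𝕜 := ℂ)
      (UniformSpace.Completion.denseRange_coe (α := FormSpace ht hC)) fun u => ?_
    refine tendsto_nhds_unique (tendsto_const_nhds.inner hw) ?_
    simpa [UniformSpace.Completion.inner_coe] using hinner ((toFormSpace ht hC).symm u)
  have hnorm := hw.norm
  simp only [Function.comp_apply, UniformSpace.Completion.norm_coe, hw0, norm_zero] at hnorm
  exact ((tendsto_toFormSpace_zero_iff ht hC).1 hnorm).2

end OfOperator

end SesqForm

namespace WeightedGraph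

variable {X : Type*} {G : WeightedGraph X}

theorem L2.norm_apply_sq (u : G.L2) (x : X) : ‖u x‖ ^ 2 = G.μ x * ‖u.fn x‖ ^ 2 :=
  norm_lift_sq u.fn x

theorem L2.summable_norm_sq (u : G.L2) : Summable fun x => G.μ x * ‖u.fn x‖ ^ 2 :=
  (memℓp_lift_iff u.fn).1 (lp.memℓp u)

theorem L2.norm_le_of_forall_norm_fn_le {u v : G.L2} (h : ∀ x, ‖u.fn x‖ ≤ ‖v.fn x‖) :
    ‖u‖ ≤ ‖v‖ := by
  refine lp.norm_mono two_ne_zero fun x => le_of_sq_le_sq ?_ (norm_nonneg _)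
  rw [norm_apply_sq, norm_apply_sq]
  have := G.μ_pos x
  gcongr
  exact h x

/-- The pointwise absolute value in `ℓ²(X, μ)`. -/
def L2.abs (u : G.L2) : G.L2 :=
  ⟨G.lift fun x => (‖u.fn x‖ : ℂ), (memℓp_lift_iff _).2 (by simpa using u.summable_norm_sq)⟩

@[simp]
theorem L2.fn_abs (u : G.L2) (x : X) : u.abs.fn x = (‖u.fn x‖ : ℂ) := rfl

theorem L2.fn_abs_nonneg (u : G.L2) (x : X) : 0 ≤ u.abs.fn x :=
  Complex.zero_le_real.2 (norm_nonneg (u.fn x))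

theorem L2.abs_mem_Cc {u : G.L2} (hu : u ∈ G.Cc) : u.abs ∈ G.Cc :=
  Set.Finite.subset hu fun x hx => by simpa using hx

theorem L2.norm_abs_sub_le {u v : G.L2} (hv : ∀ x, 0 ≤ v.fn x) : ‖u.abs - v‖ ≤ ‖u - v‖ := by
  refine norm_le_of_forall_norm_fn_le fun x => ?_
  calc ‖(‖u.fn x‖ : ℂ) - v.fn x‖ = |‖u.fn x‖ - ‖v.fn x‖| := by
        conv_lhs => rw [Complex.eq_coe_norm_of_nonneg (hv x)]
        rw [← Complex.ofReal_sub, Complex.norm_real, Real.norm_eq_abs]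
    _ ≤ ‖u.fn x - v.fn x‖ := abs_norm_sub_norm_le _ _

theorem L2.tendsto_abs {ι : Type*} {l : Filter ι} {s : ι → G.L2} {u : G.L2}
    (hu : ∀ x, 0 ≤ u.fn x) (hs : Tendsto s l (𝓝 u)) : Tendsto (fun i => (s i).abs) l (𝓝 u) := by
  rw [tendsto_iff_norm_sub_tendsto_zero] at hs ⊢
  exact squeeze_zero (fun _ => norm_nonneg _) (fun _ => norm_abs_sub_le hu) hs

theorem dense_Cc : Dense (G.Cc : Set G.L2) := by
  classical
  intro u
  refine mem_closure_of_tendsto (lp.hasSum_single (by simp) u) (Eventually.of_forall fun s => ?_)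
  refine Submodule.sum_mem _ fun x _ => (Set.finite_singleton x).subset fun y hy => ?_
  by_contra hne
  exact hy (lp.single_apply_ne 2 x (u x) hne)

section Schrodinger

variable (hG : G.FinitenessCondition) (V : X → ℝ)

theorem mul_formalSchrodinger {f : X → ℂ} {S : Finset X} (hf : Function.support f ⊆ S) (x : X) :
    (G.μ x : ℂ) * G.formalSchrodinger V f x =
      (((∑' y, G.b x y) + G.μ x * V x : ℝ) : ℂ) * f x - ∑ y ∈ S, (G.b x y : ℂ) * f y := by
  have hμ : (G.μ x : ℂ) ≠ 0 := by exact_mod_cast (G.μ_pos x).ne'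
  have hsum : HasSum (fun y => (G.b x y : ℂ) * (f x - f y))
      ((∑' y, G.b x y : ℝ) * f x - ∑ y ∈ S, (G.b x y : ℂ) * f y) := by
    simp only [mul_sub]
    refine ((Complex.hasSum_ofReal.2 (G.b_summable x).hasSum).mul_right (f x)).sub
      (hasSum_sum_of_ne_finset_zero fun y hy => ?_)
    rw [Function.notMem_support.1 fun h => hy (hf h), mul_zero]
  rw [formalSchrodinger, hsum.tsum_eq]
  push_cast
  field_simp
  ring

theorem inner_schrodinger {u v : (G.schrodinger hG V).domain} {S : Finset X}
    (hu : Function.support (L2.fn u.1) ⊆ S) (hv : Function.support (L2.fn v.1) ⊆ S) :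
    ⟪(u : G.L2), G.schrodinger hG V v⟫_ℂ =
      ∑ x ∈ S, (((∑' y, G.b x y) + G.μ x * V x : ℝ) : ℂ) *
          (starRingEnd ℂ (L2.fn u.1 x) * L2.fn v.1 x) -
        ∑ x ∈ S, ∑ y ∈ S, (G.b x y : ℂ) * (starRingEnd ℂ (L2.fn u.1 x) * L2.fn v.1 y) := by
  rw [inner_eq, tsum_eq_sum (s := S), ← Finset.sum_sub_distrib]
  · refine Finset.sum_congr rfl fun x _ => ?_
    change (G.μ x : ℂ) * (_ * G.formalSchrodinger V (L2.fn v.1) x) = _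
    rw [mul_left_comm, mul_formalSchrodinger V hv, mul_sub, Finset.mul_sum, mul_left_comm]
    simp only [mul_left_comm (starRingEnd ℂ _)]
  · intro x hx
    rw [Function.notMem_support.1 fun h => hx (hu h), map_zero, zero_mul, mul_zero]

theorem exists_support_subset (u v : G.Cc) :
    ∃ S : Finset X, Function.support (L2.fn u.1) ⊆ S ∧ Function.support (L2.fn v.1) ⊆ S := by
  have h : (Function.support (L2.fn u.1) ∪ Function.support (L2.fn v.1)).Finite := u.2.union v.2
  exact ⟨h.toFinset, by simp, by simp⟩

theorem schrodinger_isFormalAdjoint :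
    (G.schrodinger hG V).IsFormalAdjoint (G.schrodinger hG V) := by
  intro u v
  obtain ⟨S, hu, hv⟩ := exists_support_subset u v
  rw [← inner_conj_symm, inner_schrodinger hG V hu hv, inner_schrodinger hG V hv hu,
    Finset.sum_comm (s := S) (t := S)]
  simp only [map_sub, map_sum, map_mul, Complex.conj_ofReal, Complex.conj_conj,
    mul_comm (L2.fn _ _), G.b_symm]

theorem re_inner_schrodinger_abs_le {u v : (G.schrodinger hG V).domain}
    (huv : (v : G.L2) = u.1.abs) :
    (⟪(v : G.L2), G.schrodinger hG V v⟫_ℂ).re ≤ (⟪(u : G.L2), G.schrodinger hG V u⟫_ℂ).re := by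
  obtain ⟨S, hu, hv⟩ := exists_support_subset u v
  rw [inner_schrodinger hG V hu hu, inner_schrodinger hG V hv hv]
  simp only [Complex.sub_re, Complex.re_sum, Complex.re_ofReal_mul, huv, L2.fn_abs]
  have hdiag (z : ℂ) :
      (starRingEnd ℂ (‖z‖ : ℂ) * (‖z‖ : ℂ)).re = (starRingEnd ℂ z * z).re := by
    rw [Complex.conj_mul', Complex.conj_mul', Complex.norm_real, norm_norm]
  have hoff (z w : ℂ) :
      (starRingEnd ℂ z * w).re ≤ (starRingEnd ℂ (‖z‖ : ℂ) * (‖w‖ : ℂ)).re := by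
    simpa using Complex.re_le_norm (starRingEnd ℂ z * w)
  simp only [hdiag]
  exact sub_le_sub_left (Finset.sum_le_sum fun x _ => Finset.sum_le_sum fun y _ =>
    mul_le_mul_of_nonneg_left (hoff _ _) (G.b_nonneg x y)) _

end Schrodinger

/-- The first Beurling–Deny criterion: the form domain is stable under the absolute value, which
does not increase the form. -/
def BeurlingDeny (t : SesqForm G.L2) : Prop :=
  ∀ u : t.domain, ∃ h : u.1.abs ∈ t.domain, t.quad ⟨u.1.abs, h⟩ ≤ t.quad u

theorem ofOperator_schrodinger_beurlingDeny (hG : G.FinitenessCondition) (V : X → ℝ) :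
    BeurlingDeny (SesqForm.ofOperator (G.schrodinger hG V)) :=
  fun u => ⟨L2.abs_mem_Cc u.2, re_inner_schrodinger_abs_le hG V rfl⟩

theorem BeurlingDeny.exists_tendsto_quad_sub {t c : SesqForm G.L2} (ht : BeurlingDeny t)
    (hc : c.IsClosureOf t) {u : c.domain} (hu : ∀ x, 0 ≤ L2.fn u.1 x) :
    ∃ a : ℕ → c.domain, (∀ n, (a n : G.L2) ∈ t.domain ∧ ∀ x, 0 ≤ L2.fn (a n).1 x) ∧
      Tendsto (fun n => (a n : G.L2)) atTop (𝓝 (u : G.L2)) ∧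
      Tendsto (fun n => c.quad (a n - u)) atTop (𝓝 0) := by
  obtain ⟨s, hst, hs, hq⟩ := hc.core u
  obtain ⟨hle, hform⟩ := hc.extends_form
  choose hmem hquad using fun n => ht ⟨s n, hst n⟩
  have ha : Tendsto (fun n => (s n).1.abs) atTop (𝓝 (u : G.L2)) := L2.tendsto_abs hu hs
  have hquad_c (n : ℕ) : c.quad ⟨(s n).1.abs, hle (hmem n)⟩ ≤ c.quad (s n) := by
    have := hquad n
    simp only [SesqForm.quad, ← hform] at this
    exact this
  exact ⟨fun n => ⟨(s n).1.abs, hle (hmem n)⟩, fun n => ⟨hmem n, L2.fn_abs_nonneg _⟩, ha,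
    hc.isClosed.tendsto_quad_sub_of_quad_le hc.isHermitian hc.isLowerSemibounded ha
      (SesqForm.tendsto_quad hc.isHermitian hc.isLowerSemibounded hs hq) hquad_c⟩

theorem BeurlingDeny.hasPositiveFormCore {t c : SesqForm G.L2} (ht : BeurlingDeny t)
    (hc : c.IsClosureOf t) (hdense : Dense (t.domain : Set G.L2)) (hle : t.domain ≤ G.Cc) :
    HasPositiveFormCore c.operator := by
  have hform : c.IsFormOf c.operator :=
    ⟨hdense.mono hc.extends_form.1, hc.isHermitian, hc.isLowerSemibounded, hc.isClosed, rfl⟩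
  refine ⟨c, hform, fun u hu => ?_⟩
  obtain ⟨a, ha, hau, hq⟩ := ht.exists_tendsto_quad_sub hc hu
  exact ⟨a, fun n => ⟨hle (ha n).1, (ha n).2⟩,
    fun β _ => SesqForm.tendsto_formNorm_sub hau hq β⟩

end WeightedGraph

end

theorem proposition3_general {X : Type*} (G : WeightedGraph X)
    (hG : G.FinitenessCondition) (V₁ : X → ℝ)
    (hV₁ : ∃ C : ℝ, ∀ u : (G.schrodinger hG V₁).domain,
      C * ‖(u : G.L2)‖ ^ 2 ≤ (inner ℂ (u : G.L2) (G.schrodinger hG V₁ u)).re) :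
    WeightedGraph.HasPositiveFormCore (friedrichsExtension (G.schrodinger hG V₁)) := by
  have hsymm := WeightedGraph.schrodinger_isFormalAdjoint hG V₁
  have hclosure := (SesqForm.ofOperator_isClosable hsymm hV₁).closure_isClosureOf
    (SesqForm.ofOperator_isHermitian hsymm) hV₁
  exact (WeightedGraph.ofOperator_schrodinger_beurlingDeny hG V₁).hasPositiveFormCore hclosure
    WeightedGraph.dense_Cc le_rfl

theorem proposition3 {X : Type*} [Countable X] [Nonempty X] (G : WeightedGraph X)
    (hG : G.FinitenessCondition) (V₁ : X → ℝ)
    (hV₁ : ∃ C : ℝ, ∀ u : (G.schrodinger hG V₁).domain,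
      C * ‖(u : G.L2)‖ ^ 2 ≤ (inner ℂ (u : G.L2) (G.schrodinger hG V₁ u)).re) :
    WeightedGraph.HasPositiveFormCore (friedrichsExtension (G.schrodinger hG V₁)) :=
  proposition3_general G hG V₁ hV₁
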